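/- Let $A$ and $B$ be finite nontrivial (additively written) abelian groups and let $I$ be a finite set with $|I|>1$. Let $\varphi_1\colon A\to B$ be a map with $\varphi_1(-a)=\varphi_1(a)$ for all $a\in A$, and let $\varphi_2\colon B\to A$ be a group homomorphism. Put $X=X(A,B,I)=A\times B\times I$. For $(a,b,i)\in X$ let $\sigma_{(a,b,i)}$ be the permutation of $X$ given by $$\sigma_{(a,b,i)}(c,d,j)=\begin{cases}(c,\,d+\varphi_1(a-c),\,j)&\text{if } i=j,\\ (c+\varphi_2(b),\,d,\,j)&\text{if } i\neq j,\end{cases}$$ let $r\colon X\times X\to X\times X$ be given by $r(x,y)=(\sigma_x(y),\sigma_{\sigma_x(y)}^{-1}(x))$, and let $$G=G(X,r)=\langle X\mid xy=zt \text{ whenever } r(x,y)=(z,t)\rangle$$ be the structure group of $(X,r)$. Let $\deg\colon G\to\mathbb{Z}$ be the homomorphism with $\deg(x)=1$ for all $x\in X$, and for $i\in I$ let $G_i$ be the subgroup of $G$ generated by $\{(a,b,i)\mid a\in A,\ b\in B\}$. Assume that $\varphi_1(0)=0$, that $\varphi_1(A)$ generates the group $B$, and that $\varphi_2$ is an isomorphism.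 Then $G$ is not poly-(infinite cyclic), i.e. there is no finite series $\{1\}=S_0\le S_1\le\dots\le S_m=G$ of subgroups in which each $S_k$ is normal in $S_{k+1}$ with $S_{k+1}/S_k$ infinite cyclic. Moreover, for every enumeration $I=\{i_1,\dots,i_n\}$ with $n=|I|$, the set $$H=\{g_1g_2\cdots g_n\mid g_l\in G_{i_l},\ \deg(g_l)=0 \text{ for } l=1,\dots,n\}$$ is a normal subgroup of $G$ with trivial center. -/

import Mathlib

/-- The structure group `G(X, r)` of a map `r : X × X → X × X`: the group generated by `X` subject
to the relations `x y = z t` whenever `r (x, y) = (z, t)`. -/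
abbrev YBStructureGroup {X : Type*} (r : X × X → X × X) : Type _ :=
  PresentedGroup {w : FreeGroup X | ∃ x y z t : X, r (x, y) = (z, t) ∧
    w = (FreeGroup.of x * FreeGroup.of y) * (FreeGroup.of z * FreeGroup.of t)⁻¹}

namespace YBStructureGroup

/-- The image in `G(X, r)` of a generator `x ∈ X`. -/
def of {X : Type*} (r : X × X → X × X) (x : X) : YBStructureGroup r :=
  PresentedGroup.of x

/-- The degree homomorphism `G(X, r) → ℤ` with `deg x = 1` for every `x ∈ X`. -/
def deg {X : Type*} (r : X × X → X × X) : YBStructureGroup r →* Multiplicative ℤ :=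
  PresentedGroup.toGroup (f := fun _ : X => Multiplicative.ofAdd (1 : ℤ)) (by
    rintro w ⟨x, y, z, t, -, rfl⟩
    simp)

end YBStructureGroup

/-- A group is poly-(infinite cyclic) if it has a finite series
`1 = S 0 ≤ S 1 ≤ ⋯ ≤ S n = G` of subgroups, each normal in the next one, all of whose factors
`S (i + 1) / S i` are infinite cyclic. -/
def IsPolyInfiniteCyclic (G : Type*) [Group G] : Prop :=
  ∃ (n : ℕ) (S : ℕ → Subgroup G), S 0 = ⊥ ∧ S n = ⊤ ∧
    ∀ i < n, S i ≤ S (i + 1) ∧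
      ∃ _ : ((S i).subgroupOf (S (i + 1))).Normal,
        Nonempty ((S (i + 1) ⧸ (S i).subgroupOf (S (i + 1))) ≃* Multiplicative ℤ)

namespace ABI

/-- The permutation `σ_{(a,b,i)}` of `X(A, B, I) = A × B × I`. -/
def sigma {A B I : Type*} [AddCommGroup A] [AddCommGroup B] [DecidableEq I]
    (φ₁ : A → B) (φ₂ : B →+ A) (x : A × B × I) : Equiv.Perm (A × B × I) where
  toFun y := if x.2.2 = y.2.2 then (y.1, y.2.1 + φ₁ (x.1 - y.1), y.2.2)
    else (y.1 + φ₂ x.2.1, y.2.1, y.2.2)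
  invFun y := if x.2.2 = y.2.2 then (y.1, y.2.1 - φ₁ (x.1 - y.1), y.2.2)
    else (y.1 - φ₂ x.2.1, y.2.1, y.2.2)
  left_inv y := by
    by_cases h : x.2.2 = y.2.2 <;> simp [h]
  right_inv y := by
    by_cases h : x.2.2 = y.2.2 <;> simp [h]

/-- The solution `r (x, y) = (σ_x y, σ_{σ_x y}⁻¹ x)` on `X(A, B, I) = A × B × I`. -/
def r {A B I : Type*} [AddCommGroup A] [AddCommGroup B] [DecidableEq I]
    (φ₁ : A → B) (φ₂ : B →+ A) (p : (A × B × I) × (A × B × I)) :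
    (A × B × I) × (A × B × I) :=
  (sigma φ₁ φ₂ p.1 p.2, (sigma φ₁ φ₂ (sigma φ₁ φ₂ p.1 p.2)).symm p.1)

/-- The subgroup `G_i` of the structure group `G(X(A, B, I), r)` generated by the elements
`(a, b, i)` with `a ∈ A` and `b ∈ B`. -/
def component {A B I : Type*} [AddCommGroup A] [AddCommGroup B] [DecidableEq I]
    (φ₁ : A → B) (φ₂ : B →+ A) (i : I) : Subgroup (YBStructureGroup (r (I := I) φ₁ φ₂)) :=
  Subgroup.closure {g | ∃ (a : A) (b : B), g = YBStructureGroup.of (r φ₁ φ₂) (a, b, i)}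

/-- For an enumeration `e 0, …, e (n - 1)` of `I`, the set `H` of all products `g_0 ⋯ g_{n-1}`
with `g_l ∈ G_{e l}` and `deg g_l = 0`. -/
def degreeZeroProducts {A B I : Type*} [AddCommGroup A] [AddCommGroup B] [DecidableEq I]
    (φ₁ : A → B) (φ₂ : B →+ A) {n : ℕ} (e : Fin n ≃ I) :
    Set (YBStructureGroup (r (I := I) φ₁ φ₂)) :=
  {h | ∃ g : Fin n → YBStructureGroup (r (I := I) φ₁ φ₂),
    (∀ l, g l ∈ component φ₁ φ₂ (e l) ∧
      YBStructureGroup.deg (r φ₁ φ₂) (g l) = Multiplicative.ofAdd 0) ∧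
    h = (List.ofFn g).prod}

end ABI

/-! The solution is involutive and square-free, so its structure group `G` acts on `X` by left
translations `lam` and carries an injective `1`-cocycle to `ℤ ^ X` (`cocycle_injective`).
Translations preserve the colour `i`, so summing the cocycle over one colour is a homomorphism to
`ℤ`. The common kernel `colorKer` of these homomorphisms is normal and equals `H` for every
enumeration (`coe_colorKer_eq`).

The hypotheses on `φ₁` and `φ₂` make `colorKer` transitive on each colour class
(`exists_colorKer_lam_eq`). Hence an invariant vector whose colour sums vanish is zero
(`eq_zero_of_comp_lam_symm_eq`). A central element acts trivially and has an invariant cocycle, so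
it is trivial. A transfer argument shows likewise that `colorKer` has no nontrivial homomorphism to
`ℤ`, while every nontrivial subgroup of a poly-(infinite cyclic) group has one. -/

open Equiv

namespace YBStructureGroup

variable {X : Type*} {r : X × X → X × X}

theorem closure_range_of : Subgroup.closure (Set.range (of r)) = ⊤ :=
  PresentedGroup.closure_range_of _

theorem induction_right {P : YBStructureGroup r → Prop} (one : P 1)
    (mul : ∀ g x, P g → P (g * of r x)) (mul_inv : ∀ g x, P g → P (g * (of r x)⁻¹)) (g) : P g := by
  have hg : g ∈ Subgroup.closure (Set.range (of r)) := by simp [closure_range_of]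
  induction hg using Subgroup.closure_induction_right with
  | one => exact one
  | mul_right g _ x hx ih => obtain ⟨x, rfl⟩ := hx; exact mul g x ih
  | mul_inv_cancel g _ x hx ih => obtain ⟨x, rfl⟩ := hx; exact mul_inv g x ih

theorem deg_of (x : X) : deg r (of r x) = Multiplicative.ofAdd 1 := by
  simp [deg, of]

end YBStructureGroup

/-! ### Structure groups of square-free solutions -/

/-- A square-free involutive solution `r (x, y) = (σ_x y, σ_{σ_x y}⁻¹ x)` of the Yang-Baxter
equation, described by its left translations `σ`. -/
structure IsSquareFreeSolution {X : Type*} (r : X × X → X × X) (σ : X → Perm X) : Prop where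
  r_eq : ∀ x y, r (x, y) = (σ x y, (σ (σ x y)).symm x)
  mul_eq : ∀ x y, σ x * σ y = σ (σ x y) * σ ((σ (σ x y)).symm x)
  apply_self : ∀ x, σ x x = x

namespace IsSquareFreeSolution

open YBStructureGroup

variable {X : Type*} {r : X × X → X × X} {σ : X → Perm X}

theorem symm_apply_self (h : IsSquareFreeSolution r σ) (x : X) : (σ x).symm x = x := by
  rw [Equiv.symm_apply_eq, h.apply_self]

theorem of_mul_of (h : IsSquareFreeSolution r σ) (x y : X) :
    of r x * of r y = of r (σ x y) * of r ((σ (σ x y)).symm x) := by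
  have := PresentedGroup.one_of_mem (rels := {w : FreeGroup X | ∃ x y z t : X, r (x, y) = (z, t) ∧
    w = (FreeGroup.of x * FreeGroup.of y) * (FreeGroup.of z * FreeGroup.of t)⁻¹})
    ⟨x, y, _, _, h.r_eq x y, rfl⟩
  rw [map_mul, map_inv, mul_inv_eq_one, map_mul, map_mul] at this
  exact this

theorem of_mul_of_symm (h : IsSquareFreeSolution r σ) (u v : X) :
    of r u * of r ((σ u).symm v) = of r v * of r ((σ v).symm u) := by
  simpa using h.of_mul_of u ((σ u).symm v)

/-- The action of the structure group on `X` by left translations. -/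
def lam (h : IsSquareFreeSolution r σ) : YBStructureGroup r →* Perm X :=
  PresentedGroup.toGroup (f := σ) (by
    rintro w ⟨x, y, z, t, hr, rfl⟩
    rw [h.r_eq] at hr
    obtain ⟨rfl, rfl⟩ := Prod.mk.inj hr
    rw [map_mul, map_inv, mul_inv_eq_one]
    simpa using h.mul_eq x y)

@[simp] theorem lam_of (h : IsSquareFreeSolution r σ) (x : X) : h.lam (of r x) = σ x :=
  PresentedGroup.toGroup.of _

/-- Translation by `x` for the additive structure of the structure group. -/
def shift (h : IsSquareFreeSolution r σ) (x : X) : Perm (YBStructureGroup r) where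
  toFun g := g * of r ((h.lam g).symm x)
  invFun g := g * (of r ((h.lam g).symm x))⁻¹
  left_inv g := by
    have : (h.lam (g * of r ((h.lam g).symm x))).symm x = (h.lam g).symm x := by
      rw [Equiv.symm_apply_eq]
      simp [h.apply_self]
    simp only [this, mul_inv_cancel_right]
  right_inv g := by
    have : (h.lam (g * (of r ((h.lam g).symm x))⁻¹)).symm x = (h.lam g).symm x := by
      rw [Equiv.symm_apply_eq]
      simp [h.symm_apply_self]
    simp only [this, inv_mul_cancel_right]

theorem shift_apply (h : IsSquareFreeSolution r σ) (x : X) (g : YBStructureGroup r) :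
    h.shift x g = g * of r ((h.lam g).symm x) := rfl

/-- The defining relation, read through `of_mul_of_symm`, is symmetric in the two letters. -/
theorem shift_mul_comm (h : IsSquareFreeSolution r σ) (x y : X) :
    h.shift x * h.shift y = h.shift y * h.shift x := by
  ext1 g
  have hsymm (u v : X) : (h.lam (g * of r u)).symm v = (σ u).symm ((h.lam g).symm v) := by
    rw [Equiv.symm_apply_eq, map_mul, lam_of]
    simp
  rw [Perm.mul_apply, Perm.mul_apply, shift_apply h x, shift_apply h y g, shift_apply h y,
    shift_apply h x g, hsymm, hsymm, mul_assoc, mul_assoc, h.of_mul_of_symm]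

/-! ### The bijective cocycle -/

section Cocycle

variable [DecidableEq X]

variable (σ) in
/-- The affine permutation `f ↦ e_x + σ_x f` of `ℤ ^ X`. -/
def affineGen (x : X) : Perm (X → ℤ) where
  toFun f := Pi.single x 1 + f ∘ (σ x).symm
  invFun f := (f - Pi.single x 1) ∘ σ x
  left_inv f := by ext; simp
  right_inv f := by ext; simp

theorem affineGen_apply (x : X) (f : X → ℤ) :
    affineGen σ x f = Pi.single x 1 + f ∘ (σ x).symm := rfl

theorem single_comp_symm (τ : Perm X) (x : X) (n : ℤ) :
    (Pi.single x n : X → ℤ) ∘ τ.symm = Pi.single (τ x) n := by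
  ext y
  simp [Pi.single_apply, Equiv.symm_apply_eq]

/-- The action of the structure group on `ℤ ^ X` by affine permutations. -/
def affine (h : IsSquareFreeSolution r σ) : YBStructureGroup r →* Perm (X → ℤ) :=
  PresentedGroup.toGroup (f := affineGen σ) (by
    rintro w ⟨x, y, z, t, hr, rfl⟩
    rw [h.r_eq] at hr
    obtain ⟨rfl, rfl⟩ := Prod.mk.inj hr
    rw [map_mul, map_inv, mul_inv_eq_one]
    ext1 f
    have key := congrArg Equiv.symm (h.mul_eq x y)
    have key' : ∀ a, (σ y).symm ((σ x).symm a) =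
        (σ ((σ (σ x y)).symm x)).symm ((σ (σ x y)).symm a) := fun a => DFunLike.congr_fun key a
    have hcomp (u v : X) (f : X → ℤ) : affineGen σ u (affineGen σ v f) =
        Pi.single u 1 + Pi.single (σ u v) 1 + f ∘ (σ v).symm ∘ (σ u).symm := by
      rw [affineGen_apply, affineGen_apply, add_assoc, ← single_comp_symm]
      rfl
    simp only [map_mul, FreeGroup.lift_apply_of, Perm.mul_apply, hcomp, Equiv.apply_symm_apply]
    rw [add_comm (Pi.single x 1 : X → ℤ)]
    congr 1
    ext a
    simp [key'])

theorem affine_of (h : IsSquareFreeSolution r σ) (x : X) :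
    h.affine (of r x) = affineGen σ x :=
  PresentedGroup.toGroup.of _

/-- The bijective `1`-cocycle from the structure group to `ℤ ^ X`. -/
def cocycle (h : IsSquareFreeSolution r σ) (g : YBStructureGroup r) : X → ℤ := h.affine g 0

theorem affine_add (h : IsSquareFreeSolution r σ) (g : YBStructureGroup r) (f₁ f₂ : X → ℤ) :
    h.affine g (f₁ + f₂) = h.affine g f₁ + f₂ ∘ (h.lam g).symm := by
  have hof (x : X) (f₁ f₂ : X → ℤ) :
      affineGen σ x (f₁ + f₂) = affineGen σ x f₁ + f₂ ∘ (σ x).symm := by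
    simp only [affineGen_apply, add_assoc]
    rfl
  induction g using induction_right generalizing f₁ f₂ with
  | one => simp; rfl
  | mul g x ih =>
    simp only [map_mul, Perm.mul_apply, affine_of, hof, ih, lam_of]
    rfl
  | mul_inv g x ih =>
    have hinv : (affineGen σ x)⁻¹ (f₁ + f₂) = (affineGen σ x)⁻¹ f₁ + f₂ ∘ σ x := by
      rw [Perm.inv_eq_iff_eq, hof]
      ext; simp
    simp only [map_mul, map_inv, Perm.mul_apply, affine_of, lam_of, hinv, ih]
    rfl

theorem cocycle_mul (h : IsSquareFreeSolution r σ) (g k : YBStructureGroup r) :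
    h.cocycle (g * k) = h.cocycle g + h.cocycle k ∘ (h.lam g).symm := by
  rw [cocycle, map_mul, Perm.mul_apply, cocycle, ← affine_add, zero_add, cocycle]

@[simp] theorem cocycle_one (h : IsSquareFreeSolution r σ) : h.cocycle 1 = 0 := by
  simp [cocycle]

theorem cocycle_of (h : IsSquareFreeSolution r σ) (x : X) :
    h.cocycle (of r x) = Pi.single x 1 := by
  rw [cocycle, affine_of, affineGen_apply]
  ext; simp

theorem cocycle_inv (h : IsSquareFreeSolution r σ) (g : YBStructureGroup r) :
    h.cocycle g⁻¹ = -(h.cocycle g ∘ h.lam g) := by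
  have := h.cocycle_mul g⁻¹ g
  rw [inv_mul_cancel, cocycle_one, map_inv] at this
  exact eq_neg_of_add_eq_zero_left this.symm

theorem cocycle_mul_of (h : IsSquareFreeSolution r σ) (g : YBStructureGroup r) (x : X) :
    h.cocycle (g * of r x) = h.cocycle g + Pi.single (h.lam g x) 1 := by
  rw [cocycle_mul, cocycle_of, single_comp_symm]

theorem cocycle_mul_of_inv (h : IsSquareFreeSolution r σ) (g : YBStructureGroup r) (x : X) :
    h.cocycle (g * (of r x)⁻¹) = h.cocycle g - Pi.single (h.lam g x) 1 := by
  have := h.cocycle_mul_of (g * (of r x)⁻¹) x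
  rw [inv_mul_cancel_right] at this
  rw [this, map_mul, Perm.mul_apply, map_inv, lam_of, Perm.inv_def, h.symm_apply_self]
  simp

/-- A left inverse exists: since the shifts commute, `f` determines the product of the shifts by `x`
to the powers `f x`, and this is applied to `1`. -/
theorem cocycle_injective [Finite X] (h : IsSquareFreeSolution r σ) :
    Function.Injective h.cocycle := by
  have := Fintype.ofFinite X
  let K := Subgroup.closure (Set.range h.shift)
  have : IsMulCommutative K := Subgroup.isMulCommutative_closure (by
    rintro _ ⟨x, rfl⟩ _ ⟨y, rfl⟩
    exact h.shift_mul_comm x y)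
  let _ : CommGroup K := { (inferInstance : Group K) with mul_comm := this.is_comm.comm }
  let T (x : X) : K := ⟨h.shift x, Subgroup.subset_closure ⟨x, rfl⟩⟩
  let s (f : X → ℤ) : YBStructureGroup r := (∏ x, T x ^ f x : K).1 1
  have hs (f : X → ℤ) (x : X) : s (f + Pi.single x 1) = h.shift x (s f) := by
    have h₁ : ∏ y, T y ^ (Pi.single x 1 : X → ℤ) y = T x := by
      rw [Fintype.prod_eq_single x (fun y hy => by simp [hy])]
      simp
    have h₂ : ∏ y, T y ^ (f + Pi.single x 1 : X → ℤ) y = T x * ∏ y, T y ^ f y := by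
      simp only [Pi.add_apply, zpow_add, Finset.prod_mul_distrib, h₁]
      exact mul_comm _ _
    simp only [s, h₂]
    rfl
  refine Function.LeftInverse.injective (g := s) fun g => ?_
  induction g using induction_right with
  | one => simp [s]
  | mul g x ih => simp [cocycle_mul_of, hs, ih, shift_apply]
  | mul_inv g x ih =>
    apply (h.shift (h.lam g x)).injective
    rw [← hs (h.cocycle _), cocycle_mul_of_inv, sub_add_cancel, ih, shift_apply, map_mul, map_inv, lam_of]
    have : (h.lam g * (σ x)⁻¹).symm (h.lam g x) = x := by
      rw [Equiv.symm_apply_eq]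
      simp [h.symm_apply_self]
    rw [this, inv_mul_cancel_right]

theorem cocycle_list_prod (h : IsSquareFreeSolution r σ) {L : List (YBStructureGroup r)}
    (hL : ∀ g ∈ L, h.lam g = 1) : h.cocycle L.prod = (L.map h.cocycle).sum := by
  induction L with
  | nil => simp
  | cons g L ih =>
    rw [List.prod_cons, cocycle_mul, hL g (by simp), List.map_cons, List.sum_cons,
      ih fun k hk => hL k (by simp [hk])]
    rfl

theorem cocycle_of_pow (h : IsSquareFreeSolution r σ) (x : X) (n : ℕ) :
    h.cocycle (of r x ^ n) = Pi.single x (n : ℤ) := by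
  have hfix (n : ℕ) : (σ x ^ n) x = x := by
    induction n with
    | zero => rfl
    | succ n ih => rw [pow_succ, Perm.mul_apply, h.apply_self, ih]
  induction n with
  | zero => simp
  | succ n ih =>
    rw [pow_succ, cocycle_mul_of, ih, map_pow, lam_of, hfix, ← Pi.single_add]
    simp

/-- Surjectivity, relative to an invariant set of letters: appending the letter `(lam g)⁻¹ x` or its
inverse to `g` changes the cocycle by exactly `± e_x`. -/
theorem exists_cocycle_eq [Finite X] (h : IsSquareFreeSolution r σ) {s : Set X}
    (hs : ∀ g, ∀ x ∈ s, h.lam g x ∈ s) {f : X → ℤ} (hf : ∀ x ∉ s, f x = 0) :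
    ∃ g ∈ Subgroup.closure (of r '' s), h.cocycle g = f := by
  have := Fintype.ofFinite X
  have hsymm (g) (x) (hx : x ∈ s) : (h.lam g).symm x ∈ s := by
    have := hs g⁻¹ x hx
    rwa [map_inv] at this
  have hmem : f ∈ AddSubgroup.closure ((fun x => (Pi.single x 1 : X → ℤ)) '' s) := by
    have hsum : f = ∑ x, f x • (Pi.single x 1 : X → ℤ) := by
      ext y
      simp [Finset.sum_apply, Pi.single_apply]
    rw [hsum]
    refine sum_mem fun x _ => ?_
    by_cases hx : x ∈ s
    · exact AddSubgroup.zsmul_mem _ (AddSubgroup.subset_closure (Set.mem_image_of_mem _ hx)) _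
    · simp [hf x hx]
  clear hf
  induction hmem using AddSubgroup.closure_induction_right with
  | zero => exact ⟨1, one_mem _, h.cocycle_one⟩
  | add_right f _ _ hx ih =>
    obtain ⟨x, hx, rfl⟩ := hx
    obtain ⟨g, hg, rfl⟩ := ih
    refine ⟨g * of r ((h.lam g).symm x),
      mul_mem hg (Subgroup.subset_closure (Set.mem_image_of_mem _ (hsymm g x hx))), ?_⟩
    rw [cocycle_mul_of, Equiv.apply_symm_apply]
  | add_neg_cancel f _ _ hx ih =>
    obtain ⟨x, hx, rfl⟩ := hx
    obtain ⟨g, hg, rfl⟩ := ih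
    refine ⟨g * (of r ((h.lam g).symm x))⁻¹,
      mul_mem hg (inv_mem (Subgroup.subset_closure (Set.mem_image_of_mem _ (hsymm g x hx)))), ?_⟩
    rw [cocycle_mul_of_inv, Equiv.apply_symm_apply, sub_eq_add_neg]

theorem deg_eq_sum [Fintype X] (h : IsSquareFreeSolution r σ) (g : YBStructureGroup r) :
    deg r g = Multiplicative.ofAdd (∑ x, h.cocycle g x) := by
  induction g using induction_right with
  | one => simp
  | mul g x ih =>
    simp [cocycle_mul_of, ih, deg_of, Finset.sum_add_distrib, ofAdd_add]
  | mul_inv g x ih =>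
    simp [cocycle_mul_of_inv, ih, deg_of, Finset.sum_sub_distrib, ofAdd_sub, div_eq_mul_inv]

end Cocycle

end IsSquareFreeSolution

/-! ### An obstruction to being poly-(infinite cyclic) -/

/-- If `H` lies in `S (k + 1)`, the induced map to the factor `ℤ` is trivial, so `H` lies in `S k`.
Descending the series forces `H` to be trivial. -/
theorem not_isPolyInfiniteCyclic {G : Type*} [Group G] {H : Subgroup G} (hH : H ≠ ⊥)
    (hχ : ∀ χ : H →* Multiplicative ℤ, χ = 1) : ¬ IsPolyInfiniteCyclic G := by
  rintro ⟨n, S, h0, hn, hS⟩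
  have key : ∀ k ≤ n, ¬ H ≤ S k := by
    intro k
    induction k with
    | zero => intro _ hle; exact hH (le_bot_iff.mp (h0 ▸ hle))
    | succ k ih =>
      intro hk hle
      obtain ⟨-, hN, ⟨E⟩⟩ := hS k (by omega)
      refine ih (by omega) fun g hg => ?_
      have h1 := DFunLike.congr_fun (hχ (E.toMonoidHom.comp
        ((QuotientGroup.mk' ((S k).subgroupOf (S (k + 1)))).comp (Subgroup.inclusion hle)))) ⟨g, hg⟩
      have h2 : QuotientGroup.mk' ((S k).subgroupOf (S (k + 1))) (Subgroup.inclusion hle ⟨g, hg⟩) = 1 :=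
        E.injective (h1.trans (map_one E).symm)
      rw [QuotientGroup.mk'_apply, QuotientGroup.eq_one_iff, Subgroup.mem_subgroupOf] at h2
      exact h2
  exact key n le_rfl (hn ▸ le_top)

/-! ### Colour degrees and their common kernel -/

namespace IsSquareFreeSolution

open YBStructureGroup

variable {X : Type*} {r : X × X → X × X} {σ : X → Perm X} {I : Type*} {c : X → I}

theorem color_lam (h : IsSquareFreeSolution r σ) (hc : ∀ x y, c (σ x y) = c y)
    (g : YBStructureGroup r) (x : X) : c (h.lam g x) = c x := by
  induction g using induction_right generalizing x with
  | one => simp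
  | mul g y ih => simp [ih, hc]
  | mul_inv g y ih =>
    have := hc y ((σ y).symm x)
    rw [Equiv.apply_symm_apply] at this
    simp [ih, this]

theorem color_lam_symm (h : IsSquareFreeSolution r σ) (hc : ∀ x y, c (σ x y) = c y)
    (g : YBStructureGroup r) (x : X) : c ((h.lam g).symm x) = c x := by
  have := h.color_lam hc g⁻¹ x
  rwa [map_inv] at this

theorem cocycle_eq_zero_of_mem_closure [DecidableEq X] (h : IsSquareFreeSolution r σ)
    (hc : ∀ x y, c (σ x y) = c y) {i : I} {g : YBStructureGroup r}
    (hg : g ∈ Subgroup.closure (of r '' {x | c x = i})) {x : X} (hx : c x ≠ i) :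
    h.cocycle g x = 0 := by
  induction hg using Subgroup.closure_induction_right with
  | one => simp
  | mul_right g _ _ hy ih =>
    obtain ⟨y, rfl, rfl⟩ := hy
    rw [cocycle_mul_of, Pi.add_apply, ih, Pi.single_eq_of_ne, add_zero]
    rintro rfl
    exact hx (h.color_lam hc g y)
  | mul_inv_cancel g _ _ hy ih =>
    obtain ⟨y, rfl, rfl⟩ := hy
    rw [cocycle_mul_of_inv, Pi.sub_apply, ih, Pi.single_eq_of_ne, sub_zero]
    rintro rfl
    exact hx (h.color_lam hc g y)

variable [Fintype X] [DecidableEq I]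

theorem sum_color_comp_lam_symm (h : IsSquareFreeSolution r σ) (hc : ∀ x y, c (σ x y) = c y)
    (g : YBStructureGroup r) (i : I) (f : X → ℤ) :
    ∑ x with c x = i, f ((h.lam g).symm x) = ∑ x with c x = i, f x :=
  Finset.sum_equiv (h.lam g).symm (by simp [h.color_lam_symm hc]) (by simp)

variable [DecidableEq X]

/-- The homomorphism to `ℤ` which counts the generators of colour `i`. -/
def colorDeg (h : IsSquareFreeSolution r σ) (hc : ∀ x y, c (σ x y) = c y) (i : I) :
    YBStructureGroup r →* Multiplicative ℤ where
  toFun g := Multiplicative.ofAdd (∑ x with c x = i, h.cocycle g x)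
  map_one' := by simp
  map_mul' g k := by
    simp only [cocycle_mul, Pi.add_apply, Function.comp_apply, Finset.sum_add_distrib, ofAdd_add,
      h.sum_color_comp_lam_symm hc]

/-- The subgroup of all elements whose degree in every colour is zero. -/
def colorKer (h : IsSquareFreeSolution r σ) (hc : ∀ x y, c (σ x y) = c y) :
    Subgroup (YBStructureGroup r) := ⨅ i, (h.colorDeg hc i).ker

theorem mem_colorKer (h : IsSquareFreeSolution r σ) (hc : ∀ x y, c (σ x y) = c y)
    {g : YBStructureGroup r} :
    g ∈ h.colorKer hc ↔ ∀ i, ∑ x with c x = i, h.cocycle g x = 0 := by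
  simp only [colorKer, Subgroup.mem_iInf, MonoidHom.mem_ker, colorDeg, MonoidHom.coe_mk,
    OneHom.coe_mk, ofAdd_eq_one]

instance normal_colorKer (h : IsSquareFreeSolution r σ) (hc : ∀ x y, c (σ x y) = c y) :
    (h.colorKer hc).Normal :=
  Subgroup.normal_iInf_normal fun _ => inferInstance

theorem colorDeg_of (h : IsSquareFreeSolution r σ) (hc : ∀ x y, c (σ x y) = c y) (i : I) (x : X) :
    h.colorDeg hc i (of r x) = if c x = i then Multiplicative.ofAdd 1 else 1 := by
  simp only [colorDeg, MonoidHom.coe_mk, OneHom.coe_mk, cocycle_of,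
    Finset.mem_filter, Finset.mem_univ, true_and, Pi.single_apply, Finset.sum_ite_eq']
  split_ifs <;> rfl

theorem sum_cocycle_of_mem_closure (h : IsSquareFreeSolution r σ)
    (hc : ∀ x y, c (σ x y) = c y) {i : I} {g : YBStructureGroup r}
    (hg : g ∈ Subgroup.closure (of r '' {x | c x = i})) :
    ∑ x with c x = i, h.cocycle g x = ∑ x, h.cocycle g x := by
  refine Finset.sum_subset (Finset.subset_univ _) fun x _ hx => ?_
  exact h.cocycle_eq_zero_of_mem_closure hc hg (by simpa using hx)

theorem mem_colorKer_of_mem_closure (h : IsSquareFreeSolution r σ)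
    (hc : ∀ x y, c (σ x y) = c y) {i : I} {g : YBStructureGroup r}
    (hg : g ∈ Subgroup.closure (of r '' {x | c x = i})) (hdeg : deg r g = 1) :
    g ∈ h.colorKer hc := by
  rw [mem_colorKer]
  intro j
  by_cases hj : j = i
  · subst hj
    rw [h.sum_cocycle_of_mem_closure hc hg]
    rwa [deg_eq_sum h, ofAdd_eq_one] at hdeg
  · refine Finset.sum_eq_zero fun x hx => h.cocycle_eq_zero_of_mem_closure hc hg ?_
    rw [(Finset.mem_filter.mp hx).2]
    exact hj

/-- The part of `f` in the first colour is realised by the first factor, and induction on the number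
of colours handles the rest. -/
theorem exists_prod_cocycle_eq (h : IsSquareFreeSolution r σ) (hc : ∀ x y, c (σ x y) = c y)
    {n : ℕ} {e : Fin n → I} (he : Function.Injective e) {f : X → ℤ}
    (hf : ∀ x, f x ≠ 0 → c x ∈ Set.range e) (hsum : ∀ i, ∑ x with c x = i, f x = 0) :
    ∃ g : Fin n → YBStructureGroup r,
      (∀ l, g l ∈ Subgroup.closure (of r '' {x | c x = e l}) ∧ deg r (g l) = 1) ∧
      h.cocycle (List.ofFn g).prod = f := by
  induction n generalizing f with
  | zero =>
    refine ⟨fun _ => 1, fun l => l.elim0, ?_⟩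
    ext x
    by_contra hx
    obtain ⟨l, -⟩ := hf x (by simpa using Ne.symm hx)
    exact l.elim0
  | succ n ih =>
    obtain ⟨g₀, hg₀, hcoc⟩ := h.exists_cocycle_eq (s := {x | c x = e 0})
      (f := fun x => if c x = e 0 then f x else 0)
      (fun g x hx => (h.color_lam hc g x).trans hx) (fun x hx => if_neg hx)
    let f' : X → ℤ := fun x => if c x = e 0 then 0 else f x
    -- The cocycle of the remaining product is twisted by `g₀`, so the remainder is pulled back
    -- along `lam g₀` to compensate.
    obtain ⟨g, hg, hprod⟩ := ih (e := e ∘ Fin.succ) (he.comp (Fin.succ_injective n))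
      (f := f' ∘ h.lam g₀) (by
        intro x hx
        have hx' : c x ≠ e 0 ∧ f (h.lam g₀ x) ≠ 0 := by
          simpa [f', h.color_lam hc] using hx
        obtain ⟨l, hl⟩ := hf _ hx'.2
        rw [h.color_lam hc] at hl
        cases l using Fin.cases with
        | zero => exact absurd hl.symm hx'.1
        | succ l => exact ⟨l, hl⟩) (by
        intro i
        rw [← h.sum_color_comp_lam_symm hc g₀ i]
        simp only [Function.comp_apply, Equiv.apply_symm_apply]
        by_cases hi : i = e 0
        · refine Finset.sum_eq_zero fun x hx => if_pos ?_
          rw [(Finset.mem_filter.mp hx).2, hi]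
        · rw [← hsum i]
          refine Finset.sum_congr rfl fun x hx => if_neg ?_
          rwa [(Finset.mem_filter.mp hx).2])
    refine ⟨Fin.cons g₀ g, fun l => ?_, ?_⟩
    · cases l using Fin.cases with
      | zero =>
        refine ⟨hg₀, ?_⟩
        rw [Fin.cons_zero, deg_eq_sum h, ofAdd_eq_one, ← h.sum_cocycle_of_mem_closure hc hg₀,
          ← hsum (e 0), hcoc]
        exact Finset.sum_congr rfl fun x hx => if_pos (Finset.mem_filter.mp hx).2
      | succ l => exact hg l
    · rw [List.ofFn_succ, List.prod_cons, cocycle_mul]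
      simp only [Fin.cons_zero, Fin.cons_succ]
      rw [hprod, hcoc]
      ext x
      by_cases hx : c x = e 0 <;> simp [f', hx]

theorem coe_colorKer_eq (h : IsSquareFreeSolution r σ) (hc : ∀ x y, c (σ x y) = c y)
    {n : ℕ} (e : Fin n ≃ I) :
    (h.colorKer hc : Set (YBStructureGroup r)) = {k | ∃ g : Fin n → YBStructureGroup r,
      (∀ l, g l ∈ Subgroup.closure (of r '' {x | c x = e l}) ∧ deg r (g l) = 1) ∧
      k = (List.ofFn g).prod} := by
  ext k
  constructor
  · intro hk
    obtain ⟨g, hg, hprod⟩ := h.exists_prod_cocycle_eq hc e.injective (f := h.cocycle k)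
      (fun x _ => e.surjective _) ((h.mem_colorKer hc).mp hk)
    exact ⟨g, hg, (h.cocycle_injective hprod).symm⟩
  · rintro ⟨g, hg, rfl⟩
    refine list_prod_mem fun k hk => ?_
    obtain ⟨l, rfl⟩ := (List.mem_ofFn' _ _).mp hk
    exact h.mem_colorKer_of_mem_closure hc (hg l).1 (hg l).2

theorem of_pow_mul_of_pow_inv_mem_colorKer (h : IsSquareFreeSolution r σ)
    (hc : ∀ x y, c (σ x y) = c y) {x y : X} (hxy : c x = c y) (m : ℕ) :
    of r x ^ m * (of r y ^ m)⁻¹ ∈ h.colorKer hc := by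
  simp [colorKer, Subgroup.mem_iInf, MonoidHom.mem_ker, colorDeg_of, hxy]

/-- By transitivity `f` is constant on each colour class, so its sum there is the class size times
that constant. -/
theorem eq_zero_of_comp_lam_symm_eq (h : IsSquareFreeSolution r σ) (hc : ∀ x y, c (σ x y) = c y)
    (htrans : ∀ x y, c x = c y → ∃ g ∈ h.colorKer hc, h.lam g x = y) {f : X → ℤ}
    (hsum : ∀ i, ∑ x with c x = i, f x = 0) (hf : ∀ g ∈ h.colorKer hc, ∀ x, f (h.lam g x) = f x) :
    f = 0 := by
  ext x
  have h1 : ∑ y with c y = c x, f y = ∑ y with c y = c x, f x := by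
    refine Finset.sum_congr rfl fun y hy => ?_
    obtain ⟨g, hg, hgx⟩ := htrans x y (Finset.mem_filter.mp hy).2.symm
    rw [← hgx, hf g hg]
  rw [hsum, Finset.sum_const, eq_comm, smul_eq_zero] at h1
  refine h1.resolve_left fun h0 => ?_
  have h0' : x ∈ Finset.univ.filter fun y => c y = c x := by simp
  exact Finset.card_ne_zero_of_mem h0' (by exact_mod_cast h0)

theorem center_colorKer_eq_bot (h : IsSquareFreeSolution r σ) (hc : ∀ x y, c (σ x y) = c y)
    (hne : ∀ x, ∃ y, y ≠ x ∧ c y = c x)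
    (htrans : ∀ x y, c x = c y → ∃ g ∈ h.colorKer hc, h.lam g x = y) :
    Subgroup.center (h.colorKer hc) = ⊥ := by
  rw [eq_bot_iff]
  rintro ⟨k, hk⟩ hcent
  rw [Subgroup.mem_center_iff] at hcent
  have hcomm (g) (hg : g ∈ h.colorKer hc) : g * k = k * g :=
    congrArg Subtype.val (hcent ⟨g, hg⟩)
  have hlam : h.lam k = 1 := by
    ext x
    obtain ⟨y, hyx, hcy⟩ := hne x
    -- The `m`-th power of any element acts trivially, so `g` below acts trivially and has cocycle
    -- `m (e_x - e_y)`. Commuting with `g` forces `k` to preserve this vector, whose only positive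
    -- entry is at `x`.
    let m := Nat.card (Perm X)
    have hm : m ≠ 0 := Nat.card_pos.ne'
    let g := of r x ^ m * (of r y ^ m)⁻¹
    have hker (z : X) : h.lam (of r z ^ m) = 1 := by
      rw [map_pow]; exact pow_card_eq_one'
    have hg : h.lam g = 1 := by simp only [g, map_mul, map_inv, hker]; simp
    have hcoc : h.cocycle g = Pi.single x (m : ℤ) - Pi.single y (m : ℤ) := by
      rw [cocycle_mul, cocycle_inv, hker, hker, cocycle_of_pow, cocycle_of_pow, sub_eq_add_neg]
      rfl
    have heq := congrArg h.cocycle (hcomm g (h.of_pow_mul_of_pow_inv_mem_colorKer hc hcy.symm m))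
    rw [cocycle_mul h g k, cocycle_mul h k g, hg, hcoc, add_comm] at heq
    have heq' := congrFun (add_left_cancel heq) (h.lam k x)
    by_contra hx
    rw [Perm.one_apply] at hx
    simp only [Pi.sub_apply, Function.comp_apply, Equiv.symm_apply_apply, Pi.single_eq_same,
      Pi.single_eq_of_ne hx, Pi.single_eq_of_ne hyx.symm] at heq'
    have hnn : (0 : ℤ) ≤ (Pi.single y (m : ℤ) : X → ℤ) (h.lam k x) := by
      rw [Pi.single_apply]; positivity
    omega
  have hz : h.cocycle k = 0 := by
    -- As `k` acts trivially, commuting with `g` says that the cocycle of `k` is invariant under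
    -- `g`.
    refine h.eq_zero_of_comp_lam_symm_eq hc htrans ((h.mem_colorKer hc).mp hk) fun g hg x => ?_
    have heq := congrArg h.cocycle (hcomm g hg)
    rw [cocycle_mul, cocycle_mul, hlam, add_comm] at heq
    have := congrFun (add_right_cancel (heq : _ = h.cocycle k + h.cocycle g)) (h.lam g x)
    simpa using this.symm
  rw [Subgroup.mem_bot]
  exact Subtype.ext (h.cocycle_injective (hz.trans h.cocycle_one.symm))

theorem colorKer_ne_bot [Nonempty X] (h : IsSquareFreeSolution r σ) (hc : ∀ x y, c (σ x y) = c y)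
    (hne : ∀ x, ∃ y, y ≠ x ∧ c y = c x) : h.colorKer hc ≠ ⊥ := by
  intro hbot
  obtain ⟨y, hyx, hcy⟩ := hne (Classical.arbitrary X)
  have hmem := h.of_pow_mul_of_pow_inv_mem_colorKer hc hcy 1
  rw [hbot, Subgroup.mem_bot, mul_inv_eq_one, pow_one, pow_one] at hmem
  have := congrFun (congrArg h.cocycle hmem) y
  simp [cocycle_of, hyx] at this

/-- For `t` acting trivially, the product of its conjugates over the finite image `Q` of the action
has an invariant cocycle, hence is `1`. Its image under `χ` is also `χ t ^ |Q|`, so `χ t = 1` by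
torsion-freeness. Every element has a power acting trivially, which gives the general case. -/
theorem hom_colorKer_eq_one (h : IsSquareFreeSolution r σ) (hc : ∀ x y, c (σ x y) = c y)
    (htrans : ∀ x y, c x = c y → ∃ g ∈ h.colorKer hc, h.lam g x = y)
    (χ : h.colorKer hc →* Multiplicative ℤ) : χ = 1 := by
  classical
  have htors (a : Multiplicative ℤ) (n : ℕ) (hn : n ≠ 0) (ha : a ^ n = 1) : a = 1 := by
    have : n • a.toAdd = 0 := ha
    exact (smul_eq_zero.mp this).resolve_left hn
  let ψ := h.lam.comp (h.colorKer hc).subtype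
  have key (t : h.colorKer hc) (ht : h.lam t = 1) : χ t = 1 := by
    let Q := ψ.range
    choose ρ hρ using fun q : Q => q.2
    let k (q : Q) : h.colorKer hc := ρ q * t * (ρ q)⁻¹
    let L := (Finset.univ : Finset Q).toList
    have hlam (q : Q) : h.lam (k q) = 1 := by simp [k, ht]
    have hcoc (q : Q) : h.cocycle (k q) = h.cocycle t ∘ (q : Perm X).symm := by
      have hq : h.lam (ρ q) = q := hρ q
      simp only [k, Subgroup.coe_mul, Subgroup.coe_inv, cocycle_mul, cocycle_inv, map_mul, ht, hq]
      ext; simp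
    let p := (L.map k).prod
    have hp : h.cocycle p = fun x => ∑ q : Q, h.cocycle t ((q : Perm X).symm x) := by
      have : (p : YBStructureGroup r) = (L.map fun q => (k q : YBStructureGroup r)).prod := by
        simp only [p, Subgroup.val_list_prod, List.map_map]
        rfl
      rw [this, cocycle_list_prod h (by
        intro g hg
        obtain ⟨q, -, rfl⟩ := List.mem_map.mp hg
        exact hlam q), List.map_map]
      ext x
      simp only [L, Finset.sum_map_toList, Finset.sum_apply, Function.comp_apply, hcoc]
    have hp0 : p = 1 := by
      refine Subtype.ext (h.cocycle_injective (Eq.trans ?_ h.cocycle_one.symm))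
      refine h.eq_zero_of_comp_lam_symm_eq hc htrans ((h.mem_colorKer hc).mp p.2) fun g hg x => ?_
      simp only [hp]
      let q₀ : Q := ⟨h.lam g, ⟨g, hg⟩, rfl⟩
      refine Fintype.sum_equiv (Equiv.mulLeft q₀⁻¹) _ _ fun q => ?_
      rfl
    have hχ : χ p = χ t ^ Fintype.card Q := by
      have : ∀ q, χ (k q) = χ t := fun q => by
        simp only [k, map_mul, map_inv]
        rw [mul_comm (χ (ρ q)), mul_inv_cancel_right]
      simp only [p, map_list_prod, List.map_map, L]
      rw [Finset.prod_map_toList]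
      simp [this]
    rw [hp0, map_one] at hχ
    exact htors _ _ Fintype.card_ne_zero hχ.symm
  ext1 g
  refine htors _ (Nat.card (Perm X)) Nat.card_pos.ne' ?_
  rw [← map_pow]
  refine key _ ?_
  rw [Subgroup.coe_pow, map_pow]
  exact pow_card_eq_one'

end IsSquareFreeSolution

/-! ### The solution on `A × B × I` -/

namespace ABI

variable {A B I : Type*} [AddCommGroup A] [AddCommGroup B] [DecidableEq I]
  {φ₁ : A → B} {φ₂ : B →+ A}

theorem sigma_apply_of_eq (a c : A) (b d : B) (i : I) :
    sigma φ₁ φ₂ (a, b, i) (c, d, i) = (c, d + φ₁ (a - c), i) :=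
  if_pos rfl

theorem sigma_apply_of_ne (a c : A) (b d : B) {i j : I} (hij : i ≠ j) :
    sigma φ₁ φ₂ (a, b, i) (c, d, j) = (c + φ₂ b, d, j) :=
  if_neg hij

theorem sigma_symm_apply_of_eq (a c : A) (b d : B) (i : I) :
    (sigma φ₁ φ₂ (a, b, i)).symm (c, d, i) = (c, d - φ₁ (a - c), i) :=
  if_pos rfl

theorem sigma_symm_apply_of_ne (a c : A) (b d : B) {i j : I} (hij : i ≠ j) :
    (sigma φ₁ φ₂ (a, b, i)).symm (c, d, j) = (c - φ₂ b, d, j) :=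
  if_neg hij

theorem sigma_apply_color (x y : A × B × I) : (sigma φ₁ φ₂ x y).2.2 = y.2.2 := by
  obtain ⟨a, b, i⟩ := x
  obtain ⟨c, d, j⟩ := y
  by_cases hij : i = j
  · rw [hij, sigma_apply_of_eq]
  · rw [sigma_apply_of_ne _ _ _ _ hij]

theorem sigma_mul_sigma (hφ₁ : ∀ a, φ₁ (-a) = φ₁ a) (x y : A × B × I) :
    sigma φ₁ φ₂ x * sigma φ₁ φ₂ y = sigma φ₁ φ₂ (sigma φ₁ φ₂ x y) *
      sigma φ₁ φ₂ ((sigma φ₁ φ₂ (sigma φ₁ φ₂ x y)).symm x) := by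
  obtain ⟨a, b, i⟩ := x
  obtain ⟨c, d, j⟩ := y
  have hs : φ₁ (c - a) = φ₁ (a - c) := by rw [← hφ₁, neg_sub]
  ext1 ⟨u, v, k⟩
  rw [Perm.mul_apply, Perm.mul_apply]
  by_cases hij : i = j
  · subst hij
    rw [sigma_apply_of_eq a, sigma_symm_apply_of_eq]
    by_cases hik : i = k
    · subst hik
      simp only [sigma_apply_of_eq, add_right_comm]
    -- Evenness of `φ₁` makes the changes of the two `B`-coordinates cancel in the total translation
    -- by `φ₂`.
    · simp only [sigma_apply_of_ne _ _ _ _ hik, map_add, map_sub, hs]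
      congr 1
      abel
  · have hji := Ne.symm hij
    rw [sigma_apply_of_ne a _ _ _ hij, sigma_symm_apply_of_ne _ _ _ _ hji]
    by_cases hik : i = k
    · subst hik
      simp only [sigma_apply_of_ne _ _ _ _ hji, sigma_apply_of_eq, sub_sub, add_comm (φ₂ d)]
    · by_cases hjk : j = k
      · subst hjk
        simp only [sigma_apply_of_ne _ _ _ _ hij, sigma_apply_of_eq, add_sub_add_right_eq_sub]
      · simp only [sigma_apply_of_ne _ _ _ _ hik, sigma_apply_of_ne _ _ _ _ hjk, add_right_comm]

theorem isSquareFreeSolution (hφ₁_even : ∀ a, φ₁ (-a) = φ₁ a) (hφ₁_zero : φ₁ 0 = 0) :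
    IsSquareFreeSolution (r (I := I) φ₁ φ₂) (sigma φ₁ φ₂) where
  r_eq _ _ := rfl
  mul_eq := sigma_mul_sigma hφ₁_even
  apply_self := by
    rintro ⟨a, b, i⟩
    rw [sigma_apply_of_eq, sub_self, hφ₁_zero, add_zero]

theorem component_eq (i : I) : component φ₁ φ₂ i =
    Subgroup.closure (YBStructureGroup.of (r φ₁ φ₂) '' {x : A × B × I | x.2.2 = i}) := by
  rw [component]
  congr 1
  ext g
  constructor
  · rintro ⟨a, b, rfl⟩
    exact ⟨(a, b, i), rfl, rfl⟩
  · rintro ⟨⟨a, b, j⟩, rfl, rfl⟩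
    exact ⟨a, b, rfl⟩

open YBStructureGroup in
-- Quotients of two letters of another colour move the `A`-coordinate by any value of `φ₂`.
-- Quotients of two letters of the same colour move the `B`-coordinate by values of `φ₁`, which
-- generate `B`.
theorem exists_colorKer_lam_eq [Fintype (A × B × I)] [DecidableEq (A × B × I)] [Nontrivial I]
    (h : IsSquareFreeSolution (r (I := I) φ₁ φ₂) (sigma φ₁ φ₂)) (hφ₁_zero : φ₁ 0 = 0)
    (hφ₁_gen : AddSubgroup.closure (Set.range φ₁) = ⊤) (hφ₂ : Function.Surjective φ₂)
    (x y : A × B × I) (hxy : x.2.2 = y.2.2) :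
    ∃ g ∈ h.colorKer (c := fun x => x.2.2) sigma_apply_color, h.lam g x = y := by
  obtain ⟨a, b, i⟩ := x
  obtain ⟨a', b', j⟩ := y
  obtain rfl : i = j := hxy
  obtain ⟨j, hj⟩ := exists_ne i
  have hmem (u v : A × B × I) (huv : u.2.2 = v.2.2) :
      of (r φ₁ φ₂) u * (of (r φ₁ φ₂) v)⁻¹ ∈
        h.colorKer (c := fun x => x.2.2) sigma_apply_color := by
    simpa using h.of_pow_mul_of_pow_inv_mem_colorKer (c := fun x => x.2.2) sigma_apply_color huv 1
  have hlam (u v x : A × B × I) :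
      h.lam (of (r φ₁ φ₂) u * (of (r φ₁ φ₂) v)⁻¹) x =
        sigma φ₁ φ₂ u ((sigma φ₁ φ₂ v).symm x) := by
    rw [map_mul, map_inv, h.lam_of, h.lam_of]
    rfl
  have hfst : ∃ g ∈ h.colorKer (c := fun x => x.2.2) sigma_apply_color,
      h.lam g (a, b, i) = (a', b, i) := by
    obtain ⟨d, hd⟩ := hφ₂ (a' - a)
    refine ⟨_, hmem (0, d, j) (0, 0, j) rfl, ?_⟩
    rw [hlam, sigma_symm_apply_of_ne _ _ _ _ hj, sigma_apply_of_ne _ _ _ _ hj]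
    simp [hd]
  have hsnd (d : B) : ∃ g ∈ h.colorKer (c := fun x => x.2.2) sigma_apply_color,
      ∀ b, h.lam g (a', b, i) = (a', b + d, i) := by
    have hd : d ∈ AddSubgroup.closure (Set.range φ₁) := by simp [hφ₁_gen]
    induction hd using AddSubgroup.closure_induction with
    | mem d hd =>
      obtain ⟨u, rfl⟩ := hd
      -- At first coordinate `a'` these letters translate by `φ₁ u` and by `φ₁ 0 = 0`.
      refine ⟨_, hmem (a' + u, 0, i) (a', 0, i) rfl, fun b => ?_⟩
      rw [hlam, sigma_symm_apply_of_eq, sigma_apply_of_eq]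
      simp [hφ₁_zero]
    | zero => exact ⟨1, one_mem _, fun b => by simp⟩
    | add d₁ d₂ _ _ ih₁ ih₂ =>
      obtain ⟨g₁, hg₁, h₁⟩ := ih₁
      obtain ⟨g₂, hg₂, h₂⟩ := ih₂
      refine ⟨g₂ * g₁, mul_mem hg₂ hg₁, fun b => ?_⟩
      rw [map_mul, Perm.mul_apply, h₁, h₂, add_assoc]
    | neg d _ ih =>
      obtain ⟨g, hg, h₁⟩ := ih
      refine ⟨g⁻¹, inv_mem hg, fun b => ?_⟩
      rw [map_inv, Perm.inv_eq_iff_eq, h₁, neg_add_cancel_right]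
  obtain ⟨g₁, hg₁, h₁⟩ := hfst
  obtain ⟨g₂, hg₂, h₂⟩ := hsnd (b' - b)
  refine ⟨g₂ * g₁, mul_mem hg₂ hg₁, ?_⟩
  rw [map_mul, Perm.mul_apply, h₁, h₂, add_sub_cancel]

end ABI

theorem theorem4p4 {A B I : Type*} [AddCommGroup A] [AddCommGroup B] [DecidableEq I]
    [Finite A] [Finite B] [Finite I] [Nontrivial A] [Nontrivial B] [Nontrivial I]
    (φ₁ : A → B) (φ₂ : B →+ A)
    (hφ₁_even : ∀ a, φ₁ (-a) = φ₁ a)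
    (hφ₁_zero : φ₁ 0 = 0)
    (hφ₁_gen : AddSubgroup.closure (Set.range φ₁) = ⊤)
    (hφ₂ : Function.Bijective φ₂) :
    ¬ IsPolyInfiniteCyclic (YBStructureGroup (ABI.r (I := I) φ₁ φ₂)) ∧
    ∀ (n : ℕ) (e : Fin n ≃ I),
      ∃ H : Subgroup (YBStructureGroup (ABI.r (I := I) φ₁ φ₂)),
        (H : Set (YBStructureGroup (ABI.r (I := I) φ₁ φ₂))) = ABI.degreeZeroProducts φ₁ φ₂ e ∧
        H.Normal ∧ Subgroup.center H = ⊥ := by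
  classical
  have := Fintype.ofFinite (A × B × I)
  have h := ABI.isSquareFreeSolution (I := I) (φ₂ := φ₂) hφ₁_even hφ₁_zero
  have hc : ∀ x y : A × B × I, (ABI.sigma φ₁ φ₂ x y).2.2 = y.2.2 := ABI.sigma_apply_color
  have htrans := ABI.exists_colorKer_lam_eq h hφ₁_zero hφ₁_gen hφ₂.surjective
  have hne (x : A × B × I) : ∃ y : A × B × I, y ≠ x ∧ y.2.2 = x.2.2 := by
    obtain ⟨a, ha⟩ := exists_ne x.1
    exact ⟨(a, x.2), fun hx => ha (congrArg Prod.fst hx), rfl⟩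
  refine ⟨not_isPolyInfiniteCyclic (h.colorKer_ne_bot hc hne)
    (h.hom_colorKer_eq_one hc htrans), fun n e => ⟨h.colorKer hc, ?_, inferInstance,
    h.center_colorKer_eq_bot hc hne htrans⟩⟩
  rw [h.coe_colorKer_eq hc e]
  simp only [ABI.degreeZeroProducts, ABI.component_eq, ofAdd_zero]
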